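/- All structures are finite. A tournament $T$ consists of a finite vertex set $V(T)$ and a set $A(T)$ of arcs such that there are no loops and, for any two distinct $x,y\in V(T)$, exactly one of $xy,yx$ belongs to $A(T)$. A hypergraph $H$ consists of a finite vertex set $V(H)$ and a set $E(H)$ of subsets of $V(H)$; it is $3$-uniform if all its edges have exactly $3$ elements. A tournament $T$ is a realization of a $3$-uniform hypergraph $H$ if $V(T)=V(H)$ and the edges of $H$ are exactly the subsets $X\subseteq V(T)$ such that the induced subtournament $T[X]$ is isomorphic to the $3$-cycle $(\{0,1,2\},\{01,12,20\})$; $H$ is realizable if it has a realization. A module of a tournament $T$ is a set $M\subseteq V(T)$ such that for all $x,y\in M$ and $v\in V(T)$, if $xv,vy\in A(T)$, then $v\in M$. A module of a hypergraph $H$ is a set $M\subseteq V(H)$ such that for each $e\in E(H)$ with $e\cap M\neq\emptyset$ and $e\setminus M\neq\emptyset$, there exists $m\in M$ such that $e\cap M=\{m\}$ and $(e\setminus\{m\})\cup\{n\}\in E(H)$ for every $n\in M$. In both cases, a module $M$ is strong if for every module $N$ with $M\cap N\neq\emptyset$, one has $M\subseteq N$ or $N\subseteq M$. Theorem. If $H$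 is a realizable $3$-uniform hypergraph and $T$ is any realization of $H$, then $H$ and $T$ have exactly the same strong modules. On the other hand, their modules differ in general: there exist a $3$-uniform hypergraph $H$ and a realization $T$ of $H$ such that the set of modules of $H$ is not equal to the set of modules of $T$. -/

import Mathlib

/-- A tournament: a set of vertices together with a set of arcs joining vertices, such that no arc
is a loop and any two distinct vertices are joined by exactly one of the two possible arcs. -/
structure Tournament (α : Type*) where
  /-- The vertex set `V(T)`. -/
  vertexSet : Set α
  /-- `T.Arc x y` says that `xy` is an arc, that is, `xy ∈ A(T)`. -/
  Arc : α → α → Prop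
  left_mem : ∀ ⦃x y⦄, Arc x y → x ∈ vertexSet
  right_mem : ∀ ⦃x y⦄, Arc x y → y ∈ vertexSet
  irrefl : ∀ x, ¬ Arc x x
  asymm : ∀ ⦃x y⦄, Arc x y → ¬ Arc y x
  total : ∀ ⦃x y⦄, x ∈ vertexSet → y ∈ vertexSet → x ≠ y → Arc x y ∨ Arc y x

namespace Tournament

/-- The subtournament `T[X]` induced by `X` (used for `X ⊆ V(T)`). -/
def induce {α : Type*} (T : Tournament α) (X : Set α) : Tournament α where
  vertexSet := T.vertexSet ∩ X
  Arc x y := T.Arc x y ∧ x ∈ X ∧ y ∈ X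
  left_mem _ _ h := ⟨T.left_mem h.1, h.2.1⟩
  right_mem _ _ h := ⟨T.right_mem h.1, h.2.2⟩
  irrefl x h := T.irrefl x h.1
  asymm _ _ h h' := T.asymm h.1 h'.1
  total _ _ hx hy hne := (T.total hx.1 hy.1 hne).imp (⟨·, hx.2, hy.2⟩) (⟨·, hy.2, hx.2⟩)

/-- Two tournaments are isomorphic if some bijection between their vertex sets preserves and
reflects arcs. -/
def IsIsomorphic {α β : Type*} (T : Tournament α) (T' : Tournament β) : Prop :=
  ∃ f : T.vertexSet ≃ T'.vertexSet,
    ∀ x y : T.vertexSet, T.Arc (x : α) (y : α) ↔ T'.Arc (f x : β) (f y : β)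

/-- The 3-cycle `({0, 1, 2}, {01, 12, 20})`. -/
def threeCycle : Tournament (Fin 3) where
  vertexSet := Set.univ
  Arc i j := (i = 0 ∧ j = 1) ∨ (i = 1 ∧ j = 2) ∨ (i = 2 ∧ j = 0)
  left_mem _ _ _ := Set.mem_univ _
  right_mem _ _ _ := Set.mem_univ _
  irrefl := by decide
  asymm := by decide
  total := by
    intro x y _ _
    revert x y
    decide

/-- The `C₃`-structure of `T`: the hypergraph on `V(T)` whose edges are the subsets of `V(T)` that
induce a subtournament isomorphic to the 3-cycle. -/
def c3Structure {α : Type*} (T : Tournament α) : Hypergraph α where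
  vertexSet := T.vertexSet
  edgeSet := {X | X ⊆ T.vertexSet ∧ (T.induce X).IsIsomorphic threeCycle}
  subset_vertexSet_of_mem_edgeSet' _ h := h.1

/-- `T` is a realization of the hypergraph `H`: it has the same vertex set and `H = C₃(T)`. -/
def Realizes {α : Type*} (T : Tournament α) (H : Hypergraph α) : Prop :=
  H = T.c3Structure

/-- Modules of a tournament. -/
def IsModule {α : Type*} (T : Tournament α) (M : Set α) : Prop :=
  M ⊆ T.vertexSet ∧
    ∀ x ∈ M, ∀ y ∈ M, ∀ v ∈ T.vertexSet, T.Arc x v → T.Arc v y → v ∈ M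

/-- Strong modules of a tournament. -/
def IsStrongModule {α : Type*} (T : Tournament α) (M : Set α) : Prop :=
  T.IsModule M ∧ ∀ N : Set α, T.IsModule N → (M ∩ N).Nonempty → M ⊆ N ∨ N ⊆ M

end Tournament

namespace Hypergraph

/-- A hypergraph is `k`-uniform if each of its edges has exactly `k` elements. -/
def IsKUniform {α : Type*} (H : Hypergraph α) (k : ℕ) : Prop :=
  ∀ e ∈ H.edgeSet, e.encard = k

/-- Modules of a hypergraph. -/
def IsModule {α : Type*} (H : Hypergraph α) (M : Set α) : Prop :=
  M ⊆ H.vertexSet ∧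
    ∀ e ∈ H.edgeSet, (e ∩ M).Nonempty → (e \ M).Nonempty →
      ∃ m ∈ M, e ∩ M = {m} ∧ ∀ n ∈ M, (e \ {m}) ∪ {n} ∈ H.edgeSet

/-- Strong modules of a hypergraph. -/
def IsStrongModule {α : Type*} (H : Hypergraph α) (M : Set α) : Prop :=
  H.IsModule M ∧ ∀ N : Set α, H.IsModule N → (M ∩ N).Nonempty → M ⊆ N ∨ N ⊆ M

end Hypergraph

namespace Tournament

variable {α : Type*} {T : Tournament α} {M N A B : Set α} {a b c v w : α}

/-! Write C₃-module for a module of the C₃-structure of `T`. Every module of `T` is a C₃-module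
(`IsModule.isCycleModule`); the converse fails because of vertices that split the set. For a
C₃-module `N`, adding its splitting vertices gives a module `W` of `T` (`isModule_union_splits`),
and each splitter `v` cuts `W` into disjoint modules `A ∋ v` and `B` of `T`, both meeting `N`
(`exists_parts`). If a strong C₃-module `M` had a splitter, the part `A` of its own cut would
overlap `M`; so `M` is a module of `T`, and it is strong there since there are fewer modules to
test. Conversely, if a strong module `M` of `T` overlapped a C₃-module `N`, then `M ⊆ W`, so a
vertex of `M \ N` splits `N`; both parts of its cut are absorbed by `M`, whence `N ⊆ M`. A
transitive tournament shows that the modules differ: with no 3-cycle, every vertex subset is a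
C₃-module. -/

theorem ne_of_arc (h : T.Arc a b) : a ≠ b := by
  rintro rfl
  exact T.irrefl _ h

/-- The reversed tournament. -/
def reverse (T : Tournament α) : Tournament α where
  vertexSet := T.vertexSet
  Arc x y := T.Arc y x
  left_mem _ _ h := T.right_mem h
  right_mem _ _ h := T.left_mem h
  irrefl x h := T.irrefl x h
  asymm _ _ h h' := T.asymm h h'
  total _ _ hx hy hne := (T.total hx hy hne).symm

/-- The arcs `ab`, `bc`, `ca` are all present. -/
def Cyclic (T : Tournament α) (a b c : α) : Prop :=
  T.Arc a b ∧ T.Arc b c ∧ T.Arc c a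

theorem Cyclic.rotate (h : T.Cyclic a b c) : T.Cyclic b c a := ⟨h.2.1, h.2.2, h.1⟩

theorem mem_edgeSet_c3Structure {X : Set α} :
    X ∈ T.c3Structure.edgeSet ↔ ∃ a b c, X = {a, b, c} ∧ T.Cyclic a b c := by
  constructor
  · rintro ⟨hX, f, hf⟩
    let g (i : Fin 3) : (T.induce X).vertexSet := f.symm ⟨i, Set.mem_univ i⟩
    have hg (i j : Fin 3) (h : threeCycle.Arc i j) : T.Arc (g i) (g j) := by
      have := (hf (g i) (g j)).2 (by simpa [g] using h)
      exact this.1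
    refine ⟨g 0, g 1, g 2, ?_, hg _ _ (by simp [threeCycle]), hg _ _ (by simp [threeCycle]),
      hg _ _ (by simp [threeCycle])⟩
    ext x
    constructor
    · intro hx
      obtain ⟨i, rfl⟩ : ∃ i, (g i : α) = x :=
        ⟨_, congrArg Subtype.val (f.symm_apply_apply ⟨x, hX hx, hx⟩)⟩
      match i with
      | 0 => exact .inl rfl
      | 1 => exact .inr (.inl rfl)
      | 2 => exact .inr (.inr rfl)
    · rintro (rfl | rfl | rfl)
      exacts [(g 0).2.2, (g 1).2.2, (g 2).2.2]
  · rintro ⟨a, b, c, rfl, hab, hbc, hca⟩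
    have ha := T.left_mem hab
    have hb := T.left_mem hbc
    have hc := T.left_mem hca
    refine ⟨by rintro x (rfl | rfl | rfl) <;> assumption, ?_⟩
    let p : Fin 3 → α := ![a, b, c]
    have hp : Function.Injective p := by
      have hab' := ne_of_arc hab
      have hbc' := ne_of_arc hbc
      have hca' := ne_of_arc hca
      intro i j hij
      fin_cases i <;> fin_cases j <;> simp_all [p]
    have harc : ∀ i j, T.Arc (p i) (p j) ↔ threeCycle.Arc i j := by
      have hba := T.asymm hab
      have hcb := T.asymm hbc
      have hac := T.asymm hca
      intro i j
      fin_cases i <;> fin_cases j <;> simp_all [p, threeCycle, T.irrefl]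
    have hpX : ∀ i, p i ∈ ({a, b, c} : Set α) := by
      intro i
      fin_cases i <;> simp [p]
    have hpV : ∀ i, p i ∈ T.vertexSet := by
      intro i
      fin_cases i <;> assumption
    let g : threeCycle.vertexSet → (T.induce {a, b, c}).vertexSet :=
      fun i => ⟨p i, hpV i, hpX i⟩
    have hg : Function.Bijective g := by
      refine ⟨fun i j h => Subtype.ext (hp (congrArg Subtype.val h)), ?_⟩
      rintro ⟨x, hx, rfl | rfl | rfl⟩
      exacts [⟨⟨0, Set.mem_univ _⟩, rfl⟩, ⟨⟨1, Set.mem_univ _⟩, rfl⟩,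
        ⟨⟨2, Set.mem_univ _⟩, rfl⟩]
    let e := Equiv.ofBijective g hg
    refine ⟨e.symm, fun x y => ?_⟩
    obtain ⟨i, rfl⟩ := e.surjective x
    obtain ⟨j, rfl⟩ := e.surjective y
    rw [e.symm_apply_apply, e.symm_apply_apply]
    exact ⟨fun h => (harc i j).1 h.1, fun h => ⟨(harc i j).2 h, hpX i, hpX j⟩⟩

/-! ### Modules of the C₃-structure in terms of oriented 3-cycles. -/

/-- The modules of the `C₃`-structure, described in terms of arcs. -/
structure IsCycleModule (T : Tournament α) (M : Set α) : Prop where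
  subset : M ⊆ T.vertexSet
  mem_of_mem : ∀ ⦃a b c⦄, T.Cyclic a b c → a ∈ M → b ∈ M → c ∈ M
  replace : ∀ ⦃a b c⦄, T.Cyclic a b c → a ∈ M → b ∉ M → ∀ n ∈ M, T.Cyclic n b c

theorem IsCycleModule.reverse (h : T.IsCycleModule M) : T.reverse.IsCycleModule M where
  subset := h.subset
  mem_of_mem a b c habc ha hb := h.mem_of_mem ⟨habc.1, habc.2.2, habc.2.1⟩ hb ha
  replace a b c habc ha hb n hn := by
    have hcyc : T.Cyclic a c b := ⟨habc.2.2, habc.2.1, habc.1⟩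
    have hc : c ∉ M := fun hc => hb (h.mem_of_mem hcyc ha hc)
    have := h.replace hcyc ha hc n hn
    exact ⟨this.2.2, this.2.1, this.1⟩

theorem IsModule.reverse (h : T.IsModule M) : T.reverse.IsModule M :=
  ⟨h.1, fun x hx y hy v hv hxv hvy => h.2 y hy x hx v hv hvy hxv⟩

theorem IsModule.of_reverse (h : T.reverse.IsModule M) : T.IsModule M :=
  ⟨h.1, fun x hx y hy v hv hxv hvy => h.2 y hy x hx v hv hvy hxv⟩

theorem IsStrongModule.reverse (h : T.IsStrongModule M) : T.reverse.IsStrongModule M :=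
  ⟨h.1.reverse, fun N hN => h.2 N hN.of_reverse⟩

theorem isModule_c3Structure_of_isCycleModule (h : T.IsCycleModule M) :
    T.c3Structure.IsModule M := by
  have key : ∀ a b c, T.Cyclic a b c → a ∈ M → (({a, b, c} : Set α) \ M).Nonempty →
      ∃ m ∈ M, ({a, b, c} : Set α) ∩ M = {m} ∧
        ∀ n ∈ M, (({a, b, c} : Set α) \ {m}) ∪ {n} ∈ T.c3Structure.edgeSet := by
    intro a b c habc ha hne
    have hb : b ∉ M := by
      intro hb
      obtain ⟨x, rfl | rfl | rfl, hx⟩ := hne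
      exacts [hx ha, hx hb, hx (h.mem_of_mem habc ha hb)]
    have hc : c ∉ M := fun hc => hb (h.mem_of_mem habc.rotate.rotate hc ha)
    refine ⟨a, ha, ?_, fun n hn => mem_edgeSet_c3Structure.2
      ⟨n, b, c, ?_, h.replace habc ha hb n hn⟩⟩
    · ext x
      constructor
      · rintro ⟨rfl | rfl | rfl, hx⟩
        exacts [rfl, (hb hx).elim, (hc hx).elim]
      · rintro rfl
        exact ⟨Or.inl rfl, ha⟩
    · have hba : b ≠ a := (ne_of_arc habc.1).symm
      have hca : c ≠ a := ne_of_arc habc.2.2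
      ext x
      simp only [Set.mem_union, Set.mem_sdiff, Set.mem_insert_iff, Set.mem_singleton_iff]
      grind
  refine ⟨h.subset, fun e he hin hout => ?_⟩
  obtain ⟨a, b, c, rfl, habc⟩ := mem_edgeSet_c3Structure.1 he
  have r : ({a, b, c} : Set α) = {b, c, a} := by grind
  have r' : ({a, b, c} : Set α) = {c, a, b} := by grind
  obtain ⟨x, rfl | rfl | rfl, hx⟩ := hin
  · exact key _ _ _ habc hx hout
  · rw [r] at hout ⊢
    exact key _ _ _ habc.rotate hx hout
  · rw [r'] at hout ⊢
    exact key _ _ _ habc.rotate.rotate hx hout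

/-- A triple carries two possible cyclic orientations, and the known arc `bc` selects one. -/
theorem cyclic_of_mem_edgeSet (h : ({a, b, c} : Set α) ∈ T.c3Structure.edgeSet)
    (hab : a ≠ b) (hac : a ≠ c) (hbc : T.Arc b c) : T.Cyclic a b c := by
  obtain ⟨x, y, z, he, hxyz⟩ := mem_edgeSet_c3Structure.1 h
  have hx : x ∈ ({a, b, c} : Set α) := by simp [he]
  have hy : y ∈ ({a, b, c} : Set α) := by simp [he]
  have hz : z ∈ ({a, b, c} : Set α) := by simp [he]
  have h1 := T.asymm hxyz.1
  have h2 := T.asymm hxyz.2.1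
  have h3 := T.asymm hxyz.2.2
  have i1 := T.irrefl a
  have i2 := T.irrefl b
  have i3 := T.irrefl c
  obtain ⟨k1, k2, k3⟩ := hxyz
  rcases hx with rfl | rfl | rfl <;> rcases hy with rfl | rfl | rfl <;>
    rcases hz with rfl | rfl | rfl <;>
    first
    | contradiction
    | exact ⟨by assumption, by assumption, by assumption⟩

theorem isCycleModule_of_isModule_c3Structure (h : T.c3Structure.IsModule M) :
    T.IsCycleModule M := by
  have two : ∀ ⦃a b c⦄, T.Cyclic a b c → a ∈ M → b ∈ M → c ∈ M := by
    intro a b c habc ha hb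
    by_contra hc
    obtain ⟨m, -, hm, -⟩ := h.2 {a, b, c} (mem_edgeSet_c3Structure.2 ⟨a, b, c, rfl, habc⟩)
      ⟨a, by simp, ha⟩ ⟨c, by simp, hc⟩
    have h1 : a ∈ ({m} : Set α) := hm ▸ ⟨by simp, ha⟩
    have h2 : b ∈ ({m} : Set α) := hm ▸ ⟨by simp, hb⟩
    exact ne_of_arc habc.1 (h1.trans h2.symm)
  refine ⟨h.1, two, fun a b c habc ha hb n hn => ?_⟩
  have hc : c ∉ M := fun hc => hb (two habc.rotate.rotate hc ha)
  obtain ⟨m, -, hm, hm'⟩ := h.2 {a, b, c} (mem_edgeSet_c3Structure.2 ⟨a, b, c, rfl, habc⟩)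
    ⟨a, by simp, ha⟩ ⟨b, by simp, hb⟩
  obtain rfl : a = m := by
    have h1 : a ∈ ({m} : Set α) := hm ▸ ⟨by simp, ha⟩
    exact h1
  have hba : b ≠ a := (ne_of_arc habc.1).symm
  have hca : c ≠ a := ne_of_arc habc.2.2
  have he : (({a, b, c} : Set α) \ {a}) ∪ {n} = {n, b, c} := by
    ext x
    simp only [Set.mem_union, Set.mem_sdiff, Set.mem_insert_iff, Set.mem_singleton_iff]
    grind
  refine cyclic_of_mem_edgeSet (he ▸ hm' n hn) ?_ ?_ habc.2.1
  · rintro rfl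
    exact hb hn
  · rintro rfl
    exact hc hn

theorem isModule_c3Structure_iff : T.c3Structure.IsModule M ↔ T.IsCycleModule M :=
  ⟨isCycleModule_of_isModule_c3Structure, isModule_c3Structure_of_isCycleModule⟩

theorem IsModule.isCycleModule (h : T.IsModule M) : T.IsCycleModule M where
  subset := h.1
  mem_of_mem _ _ _ habc ha hb := h.2 _ hb _ ha _ (T.left_mem habc.2.2) habc.2.1 habc.2.2
  replace a b c habc ha hb n hn := by
    have hbV := T.left_mem habc.2.1
    have hcV := T.left_mem habc.2.2
    have hc : c ∉ M := fun hc => hb (h.2 _ ha _ hc _ hbV habc.1 habc.2.1)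
    refine ⟨?_, habc.2.1, ?_⟩
    · refine (T.total (h.1 hn) hbV ?_).resolve_right fun hbn => hb (h.2 _ ha _ hn _ hbV habc.1 hbn)
      rintro rfl
      exact hb hn
    · refine (T.total hcV (h.1 hn) ?_).resolve_right fun hnc =>
        hc (h.2 _ hn _ ha _ hcV hnc habc.2.2)
      rintro rfl
      exact hc hn

/-! ### Splitting vertices and the modules they produce. -/

/-- All arcs between the parts go one way, so no vertex of one part lies between two vertices of the
other. -/
theorem IsModule.of_dominating_parts (h : T.IsModule (A ∪ B))
    (hAB : ∀ a ∈ A, ∀ b ∈ B, T.Arc a b) : T.IsModule A ∧ T.IsModule B := by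
  refine ⟨⟨Set.subset_union_left.trans h.1, fun x hx y hy v hv hxv hvy => ?_⟩,
    ⟨Set.subset_union_right.trans h.1, fun x hx y hy v hv hxv hvy => ?_⟩⟩
  · refine (h.2 x (.inl hx) y (.inl hy) v hv hxv hvy).resolve_right fun hvB => ?_
    exact T.asymm hvy (hAB y hy v hvB)
  · refine (h.2 x (.inr hx) y (.inr hy) v hv hxv hvy).resolve_left fun hvA => ?_
    exact T.asymm hxv (hAB v hvA x hx)

/-- The vertex `v` outside `M` has both an in-neighbour and an out-neighbour in `M`. -/
def Splits (T : Tournament α) (v : α) (M : Set α) : Prop :=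
  v ∉ M ∧ (∃ x ∈ M, T.Arc x v) ∧ ∃ y ∈ M, T.Arc v y

theorem exists_splits_of_not_isModule (hV : M ⊆ T.vertexSet) (h : ¬ T.IsModule M) :
    ∃ v, T.Splits v M := by
  by_contra! hs
  refine h ⟨hV, fun x hx y hy v _ hxv hvy => ?_⟩
  by_contra hvM
  exact hs v ⟨hvM, ⟨x, hx, hxv⟩, y, hy, hvy⟩

/-- A non-splitter `w` sees all of `M` in one direction, which an arc from a splitter `a` also
determines: if `w` dominated `M`, an in-neighbour `x` of `a` would give the cycle `x, a, w`, and
replacing `x` by an out-neighbour of `a` would reverse an arc. -/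
theorem IsCycleModule.arc_of_not_splits (h : T.IsCycleModule M) (hwM : w ∉ M)
    (hw : ¬ T.Splits w M) (ha : a ∈ M ∨ T.Splits a M) (haw : T.Arc a w) :
    ∀ n ∈ M, T.Arc n w := by
  have hwV := T.right_mem haw
  intro n hn
  refine (T.total (h.subset hn) hwV fun e => hwM (e ▸ hn)).resolve_right fun hwn => ?_
  rcases ha with ha | ⟨haM, ⟨x, hx, hxa⟩, y, hy, hay⟩
  · exact hw ⟨hwM, ⟨a, ha, haw⟩, n, hn, hwn⟩
  · have hwx : T.Arc w x := by
      refine (T.total hwV (h.subset hx) fun e => hwM (e ▸ hx)).resolve_right fun hxw => ?_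
      exact hw ⟨hwM, ⟨x, hx, hxw⟩, n, hn, hwn⟩
    exact T.asymm hay (h.replace ⟨hxa, haw, hwx⟩ hx haM y hy).1

theorem Splits.reverse (h : T.Splits v M) : T.reverse.Splits v M := ⟨h.1, h.2.2, h.2.1⟩

/-- Adding all splitting vertices turns a module of the `C₃`-structure into a module. -/
theorem IsCycleModule.isModule_union_splits (h : T.IsCycleModule M) :
    T.IsModule (M ∪ {v | T.Splits v M}) := by
  refine ⟨Set.union_subset h.subset fun v hv => ?_, fun x hx y hy w hw hxw hwy => ?_⟩
  · obtain ⟨-, ⟨x, -, hxv⟩, -⟩ := hv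
    exact T.right_mem hxv
  · by_contra hwW
    have hwM : w ∉ M := fun h => hwW (.inl h)
    have hws : ¬ T.Splits w M := fun h => hwW (.inr h)
    have h1 := h.arc_of_not_splits hwM hws hx hxw
    have h2 := h.reverse.arc_of_not_splits hwM (fun hs => hws hs.reverse)
      (hy.imp id Splits.reverse) hwy
    have hne : M.Nonempty := by
      rcases hx with hx | ⟨-, ⟨z, hz, -⟩, -⟩
      exacts [⟨x, hx⟩, ⟨z, hz⟩]
    obtain ⟨n, hn⟩ := hne
    exact T.asymm (h1 n hn) (h2 n hn)

/-- A splitting vertex `v` cuts the module generated by `M` into two modules, the first of which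
contains `v` and dominates the second. -/
theorem IsCycleModule.exists_parts (h : T.IsCycleModule M) (hv : T.Splits v M) :
    ∃ A B, A ∪ B = M ∪ {s | T.Splits s M} ∧ T.IsModule A ∧ T.IsModule B ∧ Disjoint A B ∧
      v ∈ A ∧ (∀ n ∈ M, T.Arc n v → n ∈ A) ∧ ∀ n ∈ M, T.Arc v n → n ∈ B := by
  -- Splitters are sorted by comparing their in-neighbourhoods in `M` with that of `v`, so `v`
  -- itself falls in `A`.
  let A : Set α := {n | n ∈ M ∧ T.Arc n v} ∪
    {s | T.Splits s M ∧ ∀ n ∈ M, T.Arc n s → T.Arc n v}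
  let B : Set α := {n | n ∈ M ∧ T.Arc v n} ∪
    {s | T.Splits s M ∧ ∃ n ∈ M, T.Arc n s ∧ T.Arc v n}
  have hvV : v ∈ T.vertexSet := by
    obtain ⟨-, ⟨x, -, hxv⟩, -⟩ := hv
    exact T.right_mem hxv
  have dich : ∀ n ∈ M, T.Arc n v ∨ T.Arc v n := fun n hn =>
    T.total (h.subset hn) hvV fun e => hv.1 (e ▸ hn)
  have hU : A ∪ B = M ∪ {s | T.Splits s M} := by
    ext x
    constructor
    · rintro ((hx | hx) | (hx | hx))
      exacts [.inl hx.1, .inr hx.1, .inl hx.1, .inr hx.1]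
    · rintro (hx | hx)
      · exact (dich x hx).imp (fun k => .inl ⟨hx, k⟩) (fun k => .inl ⟨hx, k⟩)
      · by_cases k : ∀ n ∈ M, T.Arc n x → T.Arc n v
        · exact .inl (.inr ⟨hx, k⟩)
        · push Not at k
          obtain ⟨n, hn, hnx, hnv⟩ := k
          exact .inr (.inr ⟨hx, n, hn, hnx, (dich n hn).resolve_left hnv⟩)
  have hMM : ∀ n ∈ M, T.Arc n v → ∀ n' ∈ M, T.Arc v n' → T.Arc n n' := by
    intro n hn hnv n' hn' hvn'
    refine (T.total (h.subset hn) (h.subset hn') ?_).resolve_right fun k => ?_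
    · rintro rfl
      exact T.asymm hnv hvn'
    · exact hv.1 (h.mem_of_mem ⟨k, hnv, hvn'⟩ hn' hn)
  have hMS : ∀ n ∈ M, T.Arc n v → ∀ s, T.Splits s M → ∀ x ∈ M, T.Arc x s → T.Arc v x →
      T.Arc n s := by
    intro n hn hnv s hs x hx hxs hvx
    refine (T.total (h.subset hn) (T.right_mem hxs) fun e => hs.1 (e ▸ hn)).resolve_right
      fun k => ?_
    exact hs.1 (h.mem_of_mem ⟨hMM n hn hnv x hx hvx, hxs, k⟩ hn hx)
  have hSM : ∀ s, T.Splits s M → (∀ n ∈ M, T.Arc n s → T.Arc n v) → ∀ x ∈ M, T.Arc v x →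
      T.Arc s x := by
    intro s hs hsv x hx hvx
    obtain ⟨hsM, ⟨y, -, hys⟩, -⟩ := hs
    refine (T.total (T.right_mem hys) (h.subset hx) fun e => hsM (e ▸ hx)).resolve_right
      fun k => T.asymm hvx (hsv x hx k)
  have hAB : ∀ a ∈ A, ∀ b ∈ B, T.Arc a b := by
    rintro a (⟨ha, hav⟩ | ⟨ha, hav⟩) b (⟨hb, hvb⟩ | ⟨hb, x, hx, hxb, hvx⟩)
    · exact hMM a ha hav b hb hvb
    · exact hMS a ha hav b hb x hx hxb hvx
    · exact hSM a ha hav b hb hvb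
    -- Two splitters: an arc `ba` would close the cycle `x, b, a`, and replacing `x` by an
    -- in-neighbour `n` of `a` would force the arc `an`.
    · have hax := hSM a ha hav x hx hvx
      obtain ⟨haM, ⟨n, hn, hna⟩, -⟩ := ha
      refine (T.total (T.right_mem hna) (T.right_mem hxb) ?_).resolve_right fun k => ?_
      · rintro rfl
        exact T.asymm hax hxb
      · exact T.asymm hna (h.replace ⟨hxb, k, hax⟩ hx hb.1 n hn).2.2
  obtain ⟨hA, hB⟩ := IsModule.of_dominating_parts (hU ▸ h.isModule_union_splits) hAB
  refine ⟨A, B, hU, hA, hB, Set.disjoint_left.2 fun x hxA hxB => T.irrefl x (hAB x hxA x hxB),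
    .inr ⟨hv, fun _ _ k => k⟩, fun n hn k => .inl ⟨hn, k⟩, fun n hn k => .inl ⟨hn, k⟩⟩

/-! ### Comparison of the strong modules. -/

theorem isModule_of_isStrongModule_c3Structure (h : T.c3Structure.IsStrongModule M) :
    T.IsModule M := by
  have hc := isModule_c3Structure_iff.1 h.1
  by_contra hM
  obtain ⟨v, hv⟩ := exists_splits_of_not_isModule hc.subset hM
  obtain ⟨A, B, -, hA, -, hd, hvA, hin, hout⟩ := hc.exists_parts hv
  obtain ⟨hvM, ⟨x, hx, hxv⟩, y, hy, hvy⟩ := hv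
  rcases h.2 A (isModule_c3Structure_iff.2 hA.isCycleModule) ⟨x, hx, hin x hx hxv⟩ with k | k
  · exact Set.disjoint_left.1 hd (k hy) (hout y hy hvy)
  · exact hvM (k hvA)

/-- Since `v ∈ A` and `x ∈ B`, the module `M` meets both parts of the cut and lies in neither, so
strongness makes it contain both. -/
theorem IsStrongModule.subset_of_splits (h : T.IsStrongModule M) (hN : T.IsCycleModule N)
    (hv : T.Splits v N) (hvM : v ∈ M) {x : α} (hxM : x ∈ M) (hxN : x ∈ N) (hvx : T.Arc v x) :
    N ⊆ M := by
  obtain ⟨A, B, hU, hA, hB, hd, hvA, -, hout⟩ := hN.exists_parts hv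
  have hxB := hout x hxN hvx
  have hAM : A ⊆ M := (h.2 A hA ⟨v, hvM, hvA⟩).resolve_left fun k =>
    Set.disjoint_left.1 hd (k hxM) hxB
  have hBM : B ⊆ M := (h.2 B hB ⟨x, hxM, hxB⟩).resolve_left fun k =>
    Set.disjoint_left.1 hd hvA (k hvM)
  exact Set.subset_union_left.trans (hU ▸ Set.union_subset hAM hBM)

theorem isStrongModule_c3Structure_iff : T.c3Structure.IsStrongModule M ↔ T.IsStrongModule M := by
  constructor
  · intro h
    exact ⟨isModule_of_isStrongModule_c3Structure h, fun N hN =>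
      h.2 N (isModule_c3Structure_iff.2 hN.isCycleModule)⟩
  · intro h
    refine ⟨isModule_c3Structure_iff.2 h.1.isCycleModule, fun N hN hMN => ?_⟩
    have hN' := isModule_c3Structure_iff.1 hN
    obtain ⟨x, hxM, hxN⟩ := hMN
    by_contra! hcon
    obtain ⟨m, hmM, hmN⟩ := Set.not_subset.1 hcon.1
    have hMW := (h.2 _ hN'.isModule_union_splits ⟨x, hxM, .inl hxN⟩).resolve_right fun k =>
      hcon.2 (Set.subset_union_left.trans k)
    have hm : T.Splits m N := (hMW hmM).resolve_left hmN
    rcases T.total (h.1.1 hmM) (h.1.1 hxM) fun e => hmN (e ▸ hxN) with k | k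
    · exact hcon.2 (h.subset_of_splits hN' hm hmM hxM hxN k)
    -- Reversing all arcs turns the arc `xm` into the one required.
    · exact hcon.2 (h.reverse.subset_of_splits hN'.reverse hm.reverse hmM hxM hxN k)

/-- The transitive tournament on `{0, 1, 2}`. -/
def transitiveThree : Tournament ℕ where
  vertexSet := {n | n < 3}
  Arc x y := x < y ∧ y < 3
  left_mem _ _ h := h.1.trans h.2
  right_mem _ _ h := h.2
  irrefl x h := lt_irrefl x h.1
  asymm _ _ h h' := lt_asymm h.1 h'.1
  total _ _ hx hy hne := (lt_or_gt_of_ne hne).imp (⟨·, hy⟩) (⟨·, hx⟩)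

theorem notMem_edgeSet_transitiveThree (e : Set ℕ) :
    e ∉ transitiveThree.c3Structure.edgeSet := by
  intro he
  obtain ⟨a, b, c, -, hab, hbc, hca⟩ := mem_edgeSet_c3Structure.1 he
  exact lt_asymm (hab.1.trans hbc.1) hca.1

end Tournament

open Tournament in
theorem mainTheorem3 {α : Type*} :
    (∀ (H : Hypergraph α) (T : Tournament α),
      H.vertexSet.Finite → H.IsKUniform 3 → T.Realizes H →
        ∀ M : Set α, H.IsStrongModule M ↔ T.IsStrongModule M) ∧
    (∃ (H : Hypergraph ℕ) (T : Tournament ℕ),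
      H.vertexSet.Finite ∧ H.IsKUniform 3 ∧ T.Realizes H ∧
        {M : Set ℕ | H.IsModule M} ≠ {M : Set ℕ | T.IsModule M}) := by
  refine ⟨?_, transitiveThree.c3Structure, transitiveThree, Set.finite_lt_nat 3,
    fun e he => (notMem_edgeSet_transitiveThree e he).elim, rfl, fun heq => ?_⟩
  · rintro _ T - - rfl M
    exact isStrongModule_c3Structure_iff
  · have h1 : transitiveThree.c3Structure.IsModule {0, 2} := by
      refine ⟨?_, fun e he => (notMem_edgeSet_transitiveThree e he).elim⟩
      rintro x (rfl | rfl) <;> simp [c3Structure, transitiveThree]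
    have h2 : transitiveThree.IsModule {0, 2} := (Set.ext_iff.1 heq _).1 h1
    have h3 := h2.2 0 (by simp) 2 (by simp) 1 (by simp [transitiveThree])
      (by simp [transitiveThree]) (by simp [transitiveThree])
    simp at h3
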